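/- Let $m\ge 1$. All spheres are unit spheres with the round metric. A map $v\colon\mathbb S^m\to\mathbb S^{n-1}\subset\mathbb R^n$ is an *eigenmap of degree $k$* if its components are restrictions to $\mathbb S^m$ of harmonic homogeneous polynomials of degree $k$ on $\mathbb R^{m+1}$. A smooth map $\phi\colon\mathbb S^m\to\mathbb S^n$ is *harmonic* if its tension field $\tau(\phi)=\operatorname{Tr}\bar\nabla d\phi$ vanishes, and *conformal biharmonic* if $$0=\bar\Delta\tau(\phi)+\operatorname{Tr}R^{\mathbb S^n}(\tau(\phi),d\phi(\cdot))d\phi(\cdot)+\tfrac13\big(d\phi(\nabla\operatorname{Scal}^{\mathbb S^m})-2\operatorname{Scal}^{\mathbb S^m}\tau(\phi)\big)+2\operatorname{Tr}(\bar\nabla d\phi)(\operatorname{Ric}^{\mathbb S^m}(\cdot),\cdot),$$ where $\bar\nabla$ is the pull-back connection, $\bar\Delta=\operatorname{Tr}\bar\nabla^2$ and $R(X,Y)Z=\nabla_X\nabla_YZ-\nabla_Y\nabla_XZ-\nabla_{[X,Y]}Z$. **Proposition.** (1) Let $k\ge 1$, let $v\colon\mathbb S^m\to\mathbb S^{n-1}\subset\mathbb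 R^n$ be an eigenmap of degree $k$, and for $\alpha\in(0,\frac{\pi}{2})$ let $q=(\sin\alpha\cdot v,\cos\alpha)\colon\mathbb S^m\to\mathbb S^n\subset\mathbb R^{n+1}$. Then $q$ is never harmonic, and it is conformal biharmonic if and only if $$\sin^2\alpha=\frac13\,\frac{(m-1)(m-3)}{k(k+m-1)}+\frac12 .$$ If $m\neq 2$, an $\alpha\in(0,\frac{\pi}{2})$ for which $q$ is conformal biharmonic exists if and only if $$k>\tfrac16\big(\sqrt3\,\sqrt{11m^2-38m+27}-3m+3\big);\qquad(*)$$ if $m=2$, such an $\alpha$ exists for every $k\ge1$. (2) There is a $k_0\ge 1$, depending on $m$, such that every integer $k\ge k_0$ satisfies $(*)$ (this is claimed for $m\ne2$ only) and such that for every $k\ge k_0$ there are an $n$, an eigenmap $v\colon\mathbb S^m\to\mathbb S^{n-1}$ of degree $k$ and an $\alpha\in(0,\frac{\pi}{2})$ for which $q=(\sin\alpha\cdot v,\cos\alpha)$ is conformal biharmonic and not harmonic. -/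

import Mathlib

open scoped ContDiff Manifold

noncomputable section

namespace SphereMaps

/-- The unit sphere of `ℝ^a`, that is `S^{a-1}`, with the round metric. -/
abbrev USphere (a : ℕ) : Type := Metric.sphere (0 : EuclideanSpace ℝ (Fin a)) 1

/-- The nearest point `y / |y|` of the unit sphere, for `y ≠ 0`. -/
def radialProj {a : ℕ} (y : EuclideanSpace ℝ (Fin a)) (hy : y ≠ 0) : USphere a :=
  ⟨‖y‖⁻¹ • y, by
    have h : ‖y‖ ≠ 0 := norm_ne_zero_iff.mpr hy
    simp [norm_smul, inv_mul_cancel₀ h]⟩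

open Classical in
/-- The extension of a function on the unit sphere to `ℝ^a ∖ {0}` that is constant along rays
(the value at the origin is irrelevant). -/
def radialExt {a : ℕ} {W : Type*} [NormedAddCommGroup W] [NormedSpace ℝ W]
    (f : USphere a → W) (y : EuclideanSpace ℝ (Fin a)) : W :=
  if hy : y = 0 then 0 else f (radialProj y hy)

/-- The differential `df_x` of a vector-valued function on the sphere. On a vector `X` tangent to the
sphere at `x` its value is `df_x(X)`; in the normal direction `x` it is zero. -/
def sphD {a : ℕ} {W : Type*} [NormedAddCommGroup W] [NormedSpace ℝ W]
    (f : USphere a → W) (x : USphere a) : EuclideanSpace ℝ (Fin a) →L[ℝ] W :=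
  fderiv ℝ (radialExt f) (x : EuclideanSpace ℝ (Fin a))

/-- The gradient of a real function on the sphere, as a tangent vector in `ℝ^a`. -/
def sphGrad {a : ℕ} (f : USphere a → ℝ) (x : USphere a) : EuclideanSpace ℝ (Fin a) :=
  gradient (radialExt f) (x : EuclideanSpace ℝ (Fin a))

/-- Orthogonal projection of `ℝ^a` onto the tangent space `T_x S = x^⊥`. -/
def tanProj {a : ℕ} (x : USphere a) (w : EuclideanSpace ℝ (Fin a)) : EuclideanSpace ℝ (Fin a) :=
  w - (inner ℝ (x : EuclideanSpace ℝ (Fin a)) w) • (x : EuclideanSpace ℝ (Fin a))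

/-- A smooth tangent vector field on the sphere; if `w` is tangent at `x`, it takes the value `w`
at `x`. It serves to extend tangent vectors to vector fields. -/
def tanField {a : ℕ} (w : EuclideanSpace ℝ (Fin a)) (y : USphere a) : EuclideanSpace ℝ (Fin a) :=
  tanProj y w

/-- The connection `∇̄` on the pull-back bundle `φ^* T S^{b-1}`: for a section `V` along `φ`,
`∇̄_X V` is the tangential part (at `φ x`) of the derivative of `V` in the ambient space. -/
def pullD {a b : ℕ} (φ : USphere a → USphere b) (V : USphere a → EuclideanSpace ℝ (Fin b))
    (x : USphere a) (X : EuclideanSpace ℝ (Fin a)) : EuclideanSpace ℝ (Fin b) :=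
  tanProj (φ x) (sphD V x X)

/-- The Levi-Civita connection of the round sphere: `∇_X Y` is the tangential part of the
derivative of the tangent field `Y` in the ambient space. -/
def lcD {a : ℕ} (Y : USphere a → EuclideanSpace ℝ (Fin a)) (x : USphere a)
    (X : EuclideanSpace ℝ (Fin a)) : EuclideanSpace ℝ (Fin a) :=
  tanProj x (sphD Y x X)

/-- The Riemann curvature tensor of the round sphere,
`R(X, Y) Z = ∇_X ∇_Y Z - ∇_Y ∇_X Z - ∇_{[X, Y]} Z`, for `X, Y, Z` tangent at `x`
(extended to tangent fields in order to differentiate). -/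
def curv {a : ℕ} (x : USphere a) (X Y Z : EuclideanSpace ℝ (Fin a)) : EuclideanSpace ℝ (Fin a) :=
  lcD (fun y => lcD (tanField Z) y (tanField Y y)) x X
    - lcD (fun y => lcD (tanField Z) y (tanField X y)) x Y
    - lcD (tanField Z) x (sphD (tanField Y) x X - sphD (tanField X) x Y)

/-- An orthonormal basis of the tangent space `T_x S = x^⊥`. -/
def tanBasis {a : ℕ} (x : USphere a) :=
  stdOrthonormalBasis ℝ (ℝ ∙ (x : EuclideanSpace ℝ (Fin a)))ᗮ

/-- The trace `∑ B(e_i, e_i)` over an orthonormal basis of `T_x S`. -/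
def tanTrace {a : ℕ} {W : Type*} [AddCommGroup W] (x : USphere a)
    (B : EuclideanSpace ℝ (Fin a) → EuclideanSpace ℝ (Fin a) → W) : W :=
  ∑ i, B (tanBasis x i : EuclideanSpace ℝ (Fin a)) (tanBasis x i : EuclideanSpace ℝ (Fin a))

/-- The Ricci curvature of the round sphere, as an endomorphism of the tangent space. -/
def ric {a : ℕ} (x : USphere a) (X : EuclideanSpace ℝ (Fin a)) : EuclideanSpace ℝ (Fin a) :=
  tanTrace x (fun Y Z => curv x X Y Z)

/-- The scalar curvature of the round sphere. -/
def scal {a : ℕ} (x : USphere a) : ℝ :=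
  tanTrace x (fun X Y => inner ℝ (ric x X) Y)

/-- The differential `dφ` of a map between spheres. -/
def dMap {a b : ℕ} (φ : USphere a → USphere b) (x : USphere a) :
    EuclideanSpace ℝ (Fin a) →L[ℝ] EuclideanSpace ℝ (Fin b) :=
  sphD (fun y => (φ y : EuclideanSpace ℝ (Fin b))) x

/-- The second fundamental form `(∇̄ dφ)(X, Y) = ∇̄_X (dφ(Y)) - dφ(∇_X Y)`. -/
def secondForm {a b : ℕ} (φ : USphere a → USphere b) (x : USphere a)
    (X Y : EuclideanSpace ℝ (Fin a)) : EuclideanSpace ℝ (Fin b) :=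
  pullD φ (fun y => dMap φ y (tanField Y y)) x X - dMap φ x (lcD (tanField Y) x X)

/-- The tension field `τ(φ) = Tr ∇̄ dφ`. -/
def tension {a b : ℕ} (φ : USphere a → USphere b) (x : USphere a) : EuclideanSpace ℝ (Fin b) :=
  tanTrace x (secondForm φ x)

/-- The connection Laplacian `Δ̄ V = Tr ∇̄² V` on sections of the pull-back bundle, where
`∇̄²_{X, Y} V = ∇̄_X (∇̄_Y V) - ∇̄_{∇_X Y} V`. -/
def pullLaplacian {a b : ℕ} (φ : USphere a → USphere b)
    (V : USphere a → EuclideanSpace ℝ (Fin b)) (x : USphere a) : EuclideanSpace ℝ (Fin b) :=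
  tanTrace x (fun X Y =>
    pullD φ (fun y => pullD φ V y (tanField Y y)) x X - pullD φ V x (lcD (tanField Y) x X))

/-- The bitension field `τ₂(φ) = Δ̄ τ(φ) + Tr R(τ(φ), dφ(·)) dφ(·)`. -/
def bitension {a b : ℕ} (φ : USphere a → USphere b) (x : USphere a) : EuclideanSpace ℝ (Fin b) :=
  pullLaplacian φ (tension φ) x
    + tanTrace x (fun X Y => curv (φ x) (tension φ x) (dMap φ x X) (dMap φ x Y))

/-- The conformal bitension field
`τ₂ᶜ(φ) = τ₂(φ) + (1/3) (dφ(∇ Scal) - 2 Scal τ(φ)) + 2 Tr (∇̄ dφ)(Ric(·), ·)`,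
with the scalar and the Ricci curvature of the domain. -/
def conformalBitension {a b : ℕ} (φ : USphere a → USphere b) (x : USphere a) :
    EuclideanSpace ℝ (Fin b) :=
  bitension φ x
    + (1 / 3 : ℝ) • (dMap φ x (sphGrad scal x) - (2 * scal x) • tension φ x)
    + (2 : ℝ) • tanTrace x (fun X Y => secondForm φ x (ric x X) Y)

/-- Harmonic maps `S^m → S^n`: smooth maps with vanishing tension field. -/
def IsHarmonicMap {m n : ℕ} (φ : USphere (m + 1) → USphere (n + 1)) : Prop :=
  ContMDiff (𝓡 m) (𝓡 n) ∞ φ ∧ ∀ x, tension φ x = 0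

/-- Conformal biharmonic maps `S^m → S^n`: smooth maps with vanishing conformal bitension field. -/
def IsConformalBiharmonic {m n : ℕ} (φ : USphere (m + 1) → USphere (n + 1)) : Prop :=
  ContMDiff (𝓡 m) (𝓡 n) ∞ φ ∧ ∀ x, conformalBitension φ x = 0

/-- Eigenmaps of degree `k` between unit spheres: the components are restrictions to the sphere of
harmonic homogeneous polynomials of degree `k`. -/
def IsEigenmapOfDegree {a b : ℕ} (k : ℕ) (v : USphere a → USphere b) : Prop :=
  ∃ F : Fin b → MvPolynomial (Fin a) ℝ,
    (∀ i, (F i).IsHomogeneous k) ∧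
    (∀ i, ∑ j, MvPolynomial.pderiv j (MvPolynomial.pderiv j (F i)) = 0) ∧
    ∀ (x : USphere a) (i : Fin b),
      (v x : EuclideanSpace ℝ (Fin b)) i
        = MvPolynomial.eval (fun j => (x : EuclideanSpace ℝ (Fin a)) j) (F i)

/-- The map `q = (sin α · v, cos α)` into the sphere of one dimension more. -/
def coneMap {a n : ℕ} (α : ℝ) (v : USphere a → USphere n) (x : USphere a) : USphere (n + 1) :=
  ⟨WithLp.toLp 2 (Fin.snoc (α := fun _ => ℝ)
      (fun i => Real.sin α * (v x : EuclideanSpace ℝ (Fin n)) i) (Real.cos α)), by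
    have h : ‖(v x : EuclideanSpace ℝ (Fin n))‖ = 1 := by simp
    have h2 : ∑ i, ((v x : EuclideanSpace ℝ (Fin n)) i) ^ 2 = 1 := by
      have := EuclideanSpace.real_norm_sq_eq (v x : EuclideanSpace ℝ (Fin n))
      rw [h] at this
      linarith
    rw [mem_sphere_zero_iff_norm, EuclideanSpace.norm_eq, Real.sqrt_eq_one]
    simp [Fin.sum_univ_castSucc, mul_pow, ← Finset.mul_sum, h2]⟩

end SphereMaps

end

open SphereMaps

/-!
Write `μ = k (k + m - 1)`, `s = sin α`, `c = cos α`, and let `N = (-c v, s)`, a unit field along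
`q = (s v, c)` that is tangent to the target sphere and normal to the parallel containing the image.
All differential operators on the sphere are evaluated on extensions to the ambient space
(`sphD_apply_of_hasFDerivAt`).

The polynomial extension of an eigenmap `v` shows, by Euler's identity and harmonicity, that the
trace of the Hessian of `v` is `-μ v` (`isLaplaceEigenmap_of_polyMap`). Since `|v| = 1`, it follows
that `|dv|² = μ`. Projecting to the tangent space of the target gives `τ(q) = μ s c N`. As `N`
differs from a constant by a multiple of `v`, its covariant derivative is a multiple of `dv`, and
the same projected trace gives `Δ̄ τ(q) = -μ c² τ(q)`. The sphere has constant curvature one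
(`curv_eq`), so that the curvature term of the bitension field is `|dq|² τ(q) = μ s² τ(q)`, while
`Ric = (m - 1) Id` and the constant `Scal = m (m - 1)` contribute multiples of `τ(q)`. Altogether
the conformal bitension field is `μ s c (μ (2 s² - 1) - (2/3) (m - 1) (m - 3)) N`
(`IsLaplaceEigenmap.conformalBitension_coneMap`), and the equation for `sin² α` is the vanishing of
this coefficient. A solution `α` exists exactly when the prescribed value of `sin² α` lies strictly
between `0` and `1`, which is a quadratic inequality for `k` (`sin_sq_value_mem_Ioo_iff`).

Eigenmaps of each degree `k` exist (`exists_isEigenmapOfDegree`): the functions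
`Re ((⟨a, y⟩ + i ⟨b, y⟩) ^ k)` with `a ⟂ b` and `|a| = |b|` span a finite-dimensional space of
harmonic polynomials that is invariant under isometries and carries an invariant inner product. The
sum of the squares of an orthonormal basis at `y` is the squared norm of the evaluation at `y`; by
invariance it is constant on the sphere, and after rescaling the basis is the required eigenmap.
-/

open scoped ContDiff Manifold
open SphereMaps

namespace SphereMaps

/-! ### The tangential projection -/

section TangentProjection

variable {a : ℕ} (x : USphere a)

lemma inner_self_sphere : inner ℝ (x : EuclideanSpace ℝ (Fin a)) x = 1 := by
  simp

lemma coe_sphere_ne_zero : (x : EuclideanSpace ℝ (Fin a)) ≠ 0 := by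
  intro h
  simpa [h] using inner_self_sphere x

lemma tanProj_add (v w : EuclideanSpace ℝ (Fin a)) :
    tanProj x (v + w) = tanProj x v + tanProj x w := by
  simp only [tanProj, inner_add_right]; module

lemma tanProj_smul (r : ℝ) (w : EuclideanSpace ℝ (Fin a)) :
    tanProj x (r • w) = r • tanProj x w := by
  simp only [tanProj, inner_smul_right]; module

lemma tanProj_neg (w : EuclideanSpace ℝ (Fin a)) : tanProj x (-w) = -tanProj x w := by
  simp only [tanProj, inner_neg_right]; module

lemma tanProj_sum {ι : Type*} (s : Finset ι) (w : ι → EuclideanSpace ℝ (Fin a)) :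
    ∑ i ∈ s, tanProj x (w i) = tanProj x (∑ i ∈ s, w i) := by
  simp [tanProj, Finset.sum_smul, inner_sum]

@[simp] lemma tanProj_self : tanProj x (x : EuclideanSpace ℝ (Fin a)) = 0 := by simp [tanProj]

lemma inner_tanProj (w : EuclideanSpace ℝ (Fin a)) :
    inner ℝ (x : EuclideanSpace ℝ (Fin a)) (tanProj x w) = 0 := by
  simp [tanProj, inner_sub_right, inner_smul_right]

variable {x} in
lemma tanProj_eq_self {w : EuclideanSpace ℝ (Fin a)}
    (h : inner ℝ (x : EuclideanSpace ℝ (Fin a)) w = 0) : tanProj x w = w := by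
  simp [tanProj, h]

@[simp] lemma tanProj_tanProj (w : EuclideanSpace ℝ (Fin a)) :
    tanProj x (tanProj x w) = tanProj x w := tanProj_eq_self (inner_tanProj x w)

lemma inner_tanBasis (i) :
    inner ℝ (x : EuclideanSpace ℝ (Fin a)) (tanBasis x i : EuclideanSpace ℝ (Fin a)) = 0 :=
  Submodule.mem_orthogonal_singleton_iff_inner_right.1 (tanBasis x i).2

end TangentProjection

/-! ### Differentials on the sphere through ambient extensions -/

section Differential

variable {a : ℕ} {W : Type*} [NormedAddCommGroup W] [NormedSpace ℝ W]

lemma hasFDerivAt_normalize (x : USphere a) :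
    HasFDerivAt (fun y : EuclideanSpace ℝ (Fin a) => ‖y‖⁻¹ • y)
      (ContinuousLinearMap.id ℝ _ - (innerSL ℝ (x : EuclideanSpace ℝ (Fin a))).smulRight
        (x : EuclideanSpace ℝ (Fin a))) x := by
  have hx : ‖(x : EuclideanSpace ℝ (Fin a))‖ = 1 := by simp
  have h1 := (hasStrictFDerivAt_norm_sq (x : EuclideanSpace ℝ (Fin a))).hasFDerivAt.sqrt
    (by simp)
  simp only [Real.sqrt_sq (norm_nonneg _)] at h1
  have h2 := ((hasDerivAt_inv (x := ‖(x : EuclideanSpace ℝ (Fin a))‖)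
    (by simp)).comp_hasFDerivAt _ h1).smul (hasFDerivAt_id (x : EuclideanSpace ℝ (Fin a)))
  refine h2.congr_fderiv ?_
  ext1 y
  simp [hx]
  module

/-- The differential on the sphere is computed by any differentiable extension of the function to
the ambient space: the radial extension is `F` composed with `y ↦ y / |y|`, whose differential at a
point of the sphere is the tangential projection. -/
lemma sphD_apply_of_hasFDerivAt {f : USphere a → W} {F : EuclideanSpace ℝ (Fin a) → W}
    {F' : EuclideanSpace ℝ (Fin a) →L[ℝ] W} {x : USphere a} (h : ∀ y : USphere a, f y = F y)
    (hF : HasFDerivAt F F' x) (X : EuclideanSpace ℝ (Fin a)) :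
    sphD f x X = F' (tanProj x X) := by
  have hx : ‖(x : EuclideanSpace ℝ (Fin a))‖⁻¹ • (x : EuclideanSpace ℝ (Fin a)) = x := by simp
  have h1 : HasFDerivAt F F'
      (‖(x : EuclideanSpace ℝ (Fin a))‖⁻¹ • (x : EuclideanSpace ℝ (Fin a))) := by rwa [hx]
  have h2 := HasFDerivAt.comp (f := fun y : EuclideanSpace ℝ (Fin a) => ‖y‖⁻¹ • y)
    (x : EuclideanSpace ℝ (Fin a)) h1 (hasFDerivAt_normalize x)
  have h3 : radialExt f =ᶠ[nhds (x : EuclideanSpace ℝ (Fin a))] fun y => F (‖y‖⁻¹ • y) := by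
    filter_upwards [isOpen_ne.mem_nhds (coe_sphere_ne_zero x)] with y hy
    rw [radialExt, dif_neg hy, h]
    rfl
  rw [sphD, (h2.congr_of_eventuallyEq h3).fderiv]
  simp [tanProj]

lemma sphD_const (w : W) (x : USphere a) (X : EuclideanSpace ℝ (Fin a)) :
    sphD (fun _ => w) x X = 0 := by
  rw [sphD_apply_of_hasFDerivAt (fun _ => rfl) (hasFDerivAt_const w _)]
  rfl

end Differential

/-! ### Traces over the tangent space -/

section Trace

variable {a : ℕ} (x : USphere a)

/-- Parseval's identity in the tangent space. -/
lemma sum_tanBasis_inner_mul_inner (w z : EuclideanSpace ℝ (Fin a)) :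
    ∑ i, inner ℝ w (tanBasis x i : EuclideanSpace ℝ (Fin a)) *
        inner ℝ z (tanBasis x i : EuclideanSpace ℝ (Fin a))
      = inner ℝ w z - inner ℝ (x : EuclideanSpace ℝ (Fin a)) w *
        inner ℝ (x : EuclideanSpace ℝ (Fin a)) z := by
  have hmem : ∀ u, tanProj x u ∈ (ℝ ∙ (x : EuclideanSpace ℝ (Fin a)))ᗮ := fun u =>
    Submodule.mem_orthogonal_singleton_iff_inner_right.2 (inner_tanProj x u)
  have key : ∀ u i, inner ℝ u (tanBasis x i : EuclideanSpace ℝ (Fin a))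
      = inner ℝ (⟨_, hmem u⟩ : (ℝ ∙ (x : EuclideanSpace ℝ (Fin a)))ᗮ) (tanBasis x i) := by
    intro u i
    rw [Submodule.coe_inner]
    simp [tanProj, inner_sub_left, inner_smul_left, inner_tanBasis]
  simp_rw [key]
  have := (tanBasis x).sum_inner_mul_inner ⟨_, hmem w⟩ ⟨_, hmem z⟩
  simp_rw [real_inner_comm ⟨_, hmem z⟩ (tanBasis x _)] at this
  rw [this, Submodule.coe_inner]
  simp only [tanProj, inner_sub_left, inner_sub_right, inner_smul_left, inner_smul_right,
    inner_self_sphere, RCLike.conj_to_real, real_inner_comm w]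
  ring

lemma sum_tanBasis_apply_mul_apply (i j : Fin a) :
    ∑ l, (tanBasis x l : EuclideanSpace ℝ (Fin a)) i * (tanBasis x l : EuclideanSpace ℝ (Fin a)) j
      = (if i = j then 1 else 0)
        - (x : EuclideanSpace ℝ (Fin a)) i * (x : EuclideanSpace ℝ (Fin a)) j := by
  have := sum_tanBasis_inner_mul_inner x (EuclideanSpace.single i 1) (EuclideanSpace.single j 1)
  simpa [EuclideanSpace.inner_single_left, EuclideanSpace.inner_single_right, eq_comm] using this

lemma sum_tanBasis_inner_smul {w : EuclideanSpace ℝ (Fin a)}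
    (hw : inner ℝ (x : EuclideanSpace ℝ (Fin a)) w = 0) :
    ∑ i, inner ℝ w (tanBasis x i : EuclideanSpace ℝ (Fin a)) •
      (tanBasis x i : EuclideanSpace ℝ (Fin a)) = w := by
  refine ext_inner_left ℝ fun z => ?_
  simp only [inner_sum, inner_smul_right]
  rw [sum_tanBasis_inner_mul_inner, hw, zero_mul, sub_zero, real_inner_comm]

lemma inner_tanBasis_self (i) : inner ℝ (tanBasis x i : EuclideanSpace ℝ (Fin a))
    (tanBasis x i : EuclideanSpace ℝ (Fin a)) = 1 := by
  rw [← Submodule.coe_inner, real_inner_self_eq_norm_sq, (tanBasis x).norm_eq_one, one_pow]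

lemma tanTrace_congr {W : Type*} [AddCommGroup W]
    {B C : EuclideanSpace ℝ (Fin a) → EuclideanSpace ℝ (Fin a) → W}
    (h : ∀ X Y, inner ℝ (x : EuclideanSpace ℝ (Fin a)) X = 0 →
      inner ℝ (x : EuclideanSpace ℝ (Fin a)) Y = 0 → B X Y = C X Y) :
    tanTrace x B = tanTrace x C :=
  Finset.sum_congr rfl fun i _ => h _ _ (inner_tanBasis x i) (inner_tanBasis x i)

lemma tanTrace_smul_const {W : Type*} [AddCommGroup W] [Module ℝ W] {m : ℕ} (x : USphere (m + 1))
    (w : W) : tanTrace x (fun X Y => inner ℝ X Y • w) = (m : ℝ) • w := by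
  have : Fact (Module.finrank ℝ (EuclideanSpace ℝ (Fin (m + 1))) = m + 1) := ⟨by simp⟩
  have h : Module.finrank ℝ (ℝ ∙ (x : EuclideanSpace ℝ (Fin (m + 1))))ᗮ = m :=
    Submodule.finrank_orthogonal_span_singleton (coe_sphere_ne_zero x)
  simp only [tanTrace, inner_tanBasis_self, one_smul, Finset.sum_const, Finset.card_univ,
    Fintype.card_fin, h, Nat.cast_smul_eq_nsmul]

end Trace

/-! ### Curvature of the round sphere -/

section Curvature

variable {a : ℕ}

lemma lcD_tanField (Z : EuclideanSpace ℝ (Fin a)) (x : USphere a) (X : EuclideanSpace ℝ (Fin a)) :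
    lcD (tanField Z) x X = -(inner ℝ (x : EuclideanSpace ℝ (Fin a)) Z) • tanProj x X := by
  have h : HasFDerivAt (fun y : EuclideanSpace ℝ (Fin a) => Z - (inner ℝ y Z) • y) _ x :=
    (hasFDerivAt_const Z _).sub (((hasFDerivAt_id (x : EuclideanSpace ℝ (Fin a))).inner ℝ
      (hasFDerivAt_const Z _)).smul (hasFDerivAt_id _))
  rw [lcD, sphD_apply_of_hasFDerivAt (f := tanField Z) (F := fun y => Z - (inner ℝ y Z) • y)
    (fun y => rfl) h]
  simp [tanProj_add, tanProj_neg, tanProj_smul]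

lemma lcD_tanField_of_tangent {x : USphere a} {Y : EuclideanSpace ℝ (Fin a)}
    (hY : inner ℝ (x : EuclideanSpace ℝ (Fin a)) Y = 0) (X : EuclideanSpace ℝ (Fin a)) :
    lcD (tanField Y) x X = 0 := by
  rw [lcD_tanField, hY, neg_zero, zero_smul]

lemma lcD_lcD_tanField {x : USphere a} {X Y Z : EuclideanSpace ℝ (Fin a)}
    (hX : inner ℝ (x : EuclideanSpace ℝ (Fin a)) X = 0)
    (hY : inner ℝ (x : EuclideanSpace ℝ (Fin a)) Y = 0)
    (hZ : inner ℝ (x : EuclideanSpace ℝ (Fin a)) Z = 0) :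
    lcD (fun y => lcD (tanField Z) y (tanField Y y)) x X = -(inner ℝ X Z) • Y := by
  have h : HasFDerivAt (fun y : EuclideanSpace ℝ (Fin a) =>
      -(inner ℝ y Z) • (Y - (inner ℝ y Y) • y)) _ x :=
    ((hasFDerivAt_id (x : EuclideanSpace ℝ (Fin a))).inner ℝ (hasFDerivAt_const Z _)).neg.smul
      ((hasFDerivAt_const Y _).sub (((hasFDerivAt_id (x : EuclideanSpace ℝ (Fin a))).inner ℝ
      (hasFDerivAt_const Y _)).smul (hasFDerivAt_id _)))
  rw [lcD, sphD_apply_of_hasFDerivAt (F := fun y => -(inner ℝ y Z) • (Y - (inner ℝ y Y) • y))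
    (fun y => by rw [lcD_tanField, tanField, tanProj_tanProj, tanProj]) h, tanProj_eq_self hX]
  simp [tanProj, hY, hZ, inner_smul_right]

/-- The round sphere has constant curvature one. -/
lemma curv_eq {x : USphere a} {X Y Z : EuclideanSpace ℝ (Fin a)}
    (hX : inner ℝ (x : EuclideanSpace ℝ (Fin a)) X = 0)
    (hY : inner ℝ (x : EuclideanSpace ℝ (Fin a)) Y = 0)
    (hZ : inner ℝ (x : EuclideanSpace ℝ (Fin a)) Z = 0) :
    curv x X Y Z = (inner ℝ Y Z) • X - (inner ℝ X Z) • Y := by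
  rw [curv, lcD_lcD_tanField hX hY hZ, lcD_lcD_tanField hY hX hZ, lcD_tanField_of_tangent hZ]
  module

lemma ric_eq {m : ℕ} {x : USphere (m + 1)} {X : EuclideanSpace ℝ (Fin (m + 1))}
    (hX : inner ℝ (x : EuclideanSpace ℝ (Fin (m + 1))) X = 0) :
    ric x X = ((m : ℝ) - 1) • X := by
  rw [ric, tanTrace_congr x (C := fun Y Z => inner ℝ Y Z • X - inner ℝ X Z • Y)
    fun Y Z hY hZ => curv_eq hX hY hZ]
  have h1 := tanTrace_smul_const x X
  have h2 := sum_tanBasis_inner_smul x hX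
  rw [tanTrace] at h1 ⊢
  rw [Finset.sum_sub_distrib, h1, h2]
  module

lemma scal_eq {m : ℕ} (x : USphere (m + 1)) : scal x = (m : ℝ) * ((m : ℝ) - 1) := by
  rw [scal, tanTrace_congr x (C := fun X Y => inner ℝ X Y • ((m : ℝ) - 1))
    fun X Y hX hY => by rw [ric_eq hX, inner_smul_left]; simp [mul_comm], tanTrace_smul_const]
  simp

lemma sphGrad_scal {m : ℕ} (x : USphere (m + 1)) : sphGrad scal x = 0 := by
  have h : fderiv ℝ (radialExt (scal (a := m + 1))) (x : EuclideanSpace ℝ (Fin (m + 1))) = 0 := by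
    rw [funext (scal_eq (m := m))]
    ext1 X
    exact sphD_const _ x X
  rw [sphGrad, gradient, h, map_zero]

end Curvature

/-! ### Calculus for extendable functions -/

section Extendable

variable {a : ℕ} {V W : Type*} [NormedAddCommGroup V] [NormedSpace ℝ V]
  [NormedAddCommGroup W] [NormedSpace ℝ W]

/-- A function on the sphere is extendable if it is the restriction of a differentiable function
on the ambient space. For such functions the differential `sphD` obeys the usual rules. -/
def Extendable (f : USphere a → W) : Prop :=
  ∃ F : EuclideanSpace ℝ (Fin a) → W, Differentiable ℝ F ∧ ∀ y : USphere a, f y = F y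

/-- The second derivative of a function on the sphere; for `X`, `Y` tangent at `x` it is the value
of the Hessian on `(X, Y)`. -/
noncomputable def sphHess (f : USphere a → W) (x : USphere a) (X Y : EuclideanSpace ℝ (Fin a)) : W :=
  sphD (fun y => sphD f y (tanField Y y)) x X

lemma sphD_affine {f : USphere a → V} (hf : Extendable f) (L : V →L[ℝ] W) (w : W) (x : USphere a)
    (X : EuclideanSpace ℝ (Fin a)) : sphD (fun y => L (f y) + w) x X = L (sphD f x X) := by
  obtain ⟨F, hF, h⟩ := hf
  have h1 := (hF (x : EuclideanSpace ℝ (Fin a))).hasFDerivAt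
  rw [sphD_apply_of_hasFDerivAt h h1, sphD_apply_of_hasFDerivAt (F := fun y => L (F y) + w)
    (fun y => by rw [h]) ((L.hasFDerivAt.comp _ h1).add_const w)]
  rfl

lemma sphD_clm {f : USphere a → V} (hf : Extendable f) (L : V →L[ℝ] W) (x : USphere a)
    (X : EuclideanSpace ℝ (Fin a)) : sphD (fun y => L (f y)) x X = L (sphD f x X) := by
  simpa using sphD_affine hf L 0 x X

lemma sphD_inner {W : Type*} [NormedAddCommGroup W] [InnerProductSpace ℝ W] {f g : USphere a → W}
    (hf : Extendable f) (hg : Extendable g) (x : USphere a) (X : EuclideanSpace ℝ (Fin a)) :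
    sphD (fun y => inner ℝ (f y) (g y)) x X
      = inner ℝ (sphD f x X) (g x) + inner ℝ (f x) (sphD g x X) := by
  obtain ⟨F, hF, h⟩ := hf
  obtain ⟨G, hG, h'⟩ := hg
  have h1 := (hF (x : EuclideanSpace ℝ (Fin a))).hasFDerivAt
  have h2 := (hG (x : EuclideanSpace ℝ (Fin a))).hasFDerivAt
  rw [sphD_apply_of_hasFDerivAt h h1, sphD_apply_of_hasFDerivAt h' h2,
    sphD_apply_of_hasFDerivAt (F := fun y => inner ℝ (F y) (G y)) (fun y => by rw [h, h'])
      (h1.inner ℝ h2)]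
  simp [h, h', add_comm]

variable {b : ℕ}

lemma secondForm_eq (φ : USphere a → USphere b) {x : USphere a} {Y : EuclideanSpace ℝ (Fin a)}
    (hY : inner ℝ (x : EuclideanSpace ℝ (Fin a)) Y = 0) (X : EuclideanSpace ℝ (Fin a)) :
    secondForm φ x X Y
      = tanProj (φ x) (sphHess (fun y => (φ y : EuclideanSpace ℝ (Fin b))) x X Y) := by
  rw [secondForm, lcD_tanField_of_tangent hY, map_zero, sub_zero]
  rfl

lemma secondForm_smul_left (φ : USphere a → USphere b) (x : USphere a) (r : ℝ)
    (X Y : EuclideanSpace ℝ (Fin a)) :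
    secondForm φ x (r • X) Y = r • secondForm φ x X Y := by
  simp only [secondForm, pullD, lcD, map_smul, tanProj_smul, smul_sub]

lemma inner_sphD_eq_zero {φ : USphere a → USphere b}
    (hφ : Extendable fun y => (φ y : EuclideanSpace ℝ (Fin b))) (x : USphere a)
    (X : EuclideanSpace ℝ (Fin a)) :
    inner ℝ (φ x : EuclideanSpace ℝ (Fin b))
      (sphD (fun y => (φ y : EuclideanSpace ℝ (Fin b))) x X) = 0 := by
  have h := sphD_inner hφ hφ x X
  simp_rw [inner_self_sphere] at h
  rw [sphD_const, real_inner_comm] at h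
  linarith

/-- Differentiating `⟨φ, dφ(Y)⟩ = 0` expresses the pull-back metric through the Hessian. -/
lemma inner_sphD_sphD {φ : USphere a → USphere b}
    (hφ : Extendable fun y => (φ y : EuclideanSpace ℝ (Fin b)))
    {x : USphere a} {Y : EuclideanSpace ℝ (Fin a)}
    (hdφ : Extendable fun y => sphD (fun y => (φ y : EuclideanSpace ℝ (Fin b))) y (tanField Y y))
    (hY : inner ℝ (x : EuclideanSpace ℝ (Fin a)) Y = 0) (X : EuclideanSpace ℝ (Fin a)) :
    inner ℝ (sphD (fun y => (φ y : EuclideanSpace ℝ (Fin b))) x X)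
        (sphD (fun y => (φ y : EuclideanSpace ℝ (Fin b))) x Y)
      = -inner ℝ (φ x : EuclideanSpace ℝ (Fin b))
        (sphHess (fun y => (φ y : EuclideanSpace ℝ (Fin b))) x X Y) := by
  have h := sphD_inner hφ hdφ x X
  simp_rw [inner_sphD_eq_zero hφ] at h
  rw [sphD_const, tanField, tanProj_eq_self hY] at h
  rw [sphHess]
  linarith

end Extendable

/-! ### Rules for the trace -/

section TraceRules

variable {a b : ℕ} (x : USphere a)

lemma tanTrace_clm {V W : Type*} [NormedAddCommGroup V] [NormedSpace ℝ V]
    [NormedAddCommGroup W] [NormedSpace ℝ W] (L : V →L[ℝ] W)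
    (B : EuclideanSpace ℝ (Fin a) → EuclideanSpace ℝ (Fin a) → V) :
    tanTrace x (fun X Y => L (B X Y)) = L (tanTrace x B) := by
  simp [tanTrace]

lemma tanTrace_tanProj (p : USphere b)
    (B : EuclideanSpace ℝ (Fin a) → EuclideanSpace ℝ (Fin a) → EuclideanSpace ℝ (Fin b)) :
    tanTrace x (fun X Y => tanProj p (B X Y)) = tanProj p (tanTrace x B) :=
  tanProj_sum p _ _

lemma tanTrace_smul {V : Type*} [AddCommGroup V] [Module ℝ V] (r : ℝ)
    (B : EuclideanSpace ℝ (Fin a) → EuclideanSpace ℝ (Fin a) → V) :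
    tanTrace x (fun X Y => r • B X Y) = r • tanTrace x B :=
  Finset.smul_sum.symm

end TraceRules

/-! ### The tension and bitension fields of the cone map -/

section Cone

variable {n : ℕ}

/-- The inclusion `ℝ^n → ℝ^n × {0} ⊂ ℝ^(n+1)`. -/
noncomputable def equator : EuclideanSpace ℝ (Fin n) →L[ℝ] EuclideanSpace ℝ (Fin (n + 1)) :=
  LinearMap.toContinuousLinearMap
    { toFun := fun w => WithLp.toLp 2 (Fin.snoc (α := fun _ => ℝ) (fun i => w i) 0)
      map_add' := fun u w => by
        ext i
        refine Fin.lastCases ?_ (fun i => ?_) i <;> simp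
      map_smul' := fun r w => by
        ext i
        refine Fin.lastCases ?_ (fun i => ?_) i <;> simp }

/-- The last vector of the standard basis of `ℝ^(n+1)`. -/
noncomputable def pole : EuclideanSpace ℝ (Fin (n + 1)) := EuclideanSpace.single (Fin.last n) 1

@[simp] lemma equator_castSucc (w : EuclideanSpace ℝ (Fin n)) (i : Fin n) :
    equator w i.castSucc = w i := by
  simp [equator]

@[simp] lemma equator_last (w : EuclideanSpace ℝ (Fin n)) : equator w (Fin.last n) = 0 := by
  simp [equator]

lemma inner_equator (u w : EuclideanSpace ℝ (Fin n)) :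
    inner ℝ (equator u) (equator w) = inner ℝ u w := by
  simp [PiLp.inner_apply, Fin.sum_univ_castSucc]

@[simp] lemma inner_equator_pole (u : EuclideanSpace ℝ (Fin n)) :
    inner ℝ (equator u) pole = 0 := by
  simp [pole, EuclideanSpace.inner_single_right]

@[simp] lemma inner_pole_equator (u : EuclideanSpace ℝ (Fin n)) :
    inner ℝ pole (equator u) = 0 := by
  rw [real_inner_comm, inner_equator_pole]

@[simp] lemma inner_pole_pole : inner ℝ (pole (n := n)) pole = 1 := by
  simp [pole]

variable {a : ℕ}

lemma coneMap_eq (α : ℝ) (v : USphere a → USphere n) (x : USphere a) :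
    (coneMap α v x : EuclideanSpace ℝ (Fin (n + 1)))
      = (Real.sin α • equator) (v x : EuclideanSpace ℝ (Fin n)) + Real.cos α • pole := by
  ext i
  refine Fin.lastCases ?_ (fun i => ?_) i <;> simp [coneMap, pole]

/-- The unit normal, in the sphere, of the parallel `{(sin α · w, cos α)}` along `coneMap α v`. -/
noncomputable def coneNormal (α : ℝ) (v : USphere a → USphere n) (x : USphere a) :
    EuclideanSpace ℝ (Fin (n + 1)) :=
  (-Real.cos α • equator) (v x : EuclideanSpace ℝ (Fin n)) + Real.sin α • pole

lemma inner_coneNormal_self (α : ℝ) (v : USphere a → USphere n) (x : USphere a) :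
    inner ℝ (coneNormal α v x) (coneNormal α v x) = 1 := by
  simp only [coneNormal, smul_apply, inner_add_left, inner_add_right,
    inner_smul_left, inner_smul_right, inner_equator, inner_self_sphere, inner_equator_pole,
    inner_pole_equator, inner_pole_pole, RCLike.conj_to_real]
  linarith [Real.sin_sq_add_cos_sq α]

lemma inner_coneMap_coneNormal (α : ℝ) (v : USphere a → USphere n) (x : USphere a) :
    inner ℝ (coneMap α v x : EuclideanSpace ℝ (Fin (n + 1))) (coneNormal α v x) = 0 := by
  simp only [coneMap_eq, coneNormal, smul_apply, inner_add_left,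
    inner_add_right, inner_smul_left, inner_smul_right, inner_equator, inner_self_sphere,
    inner_equator_pole, inner_pole_equator, inner_pole_pole, RCLike.conj_to_real]
  ring

/-- The component of `v`, viewed in `ℝ^(n+1)`, tangent to the target sphere along the cone map. -/
lemma tanProj_coneMap_equator (α : ℝ) (v : USphere a → USphere n) (x : USphere a) :
    tanProj (coneMap α v x) (equator (v x : EuclideanSpace ℝ (Fin n)))
      = -Real.cos α • coneNormal α v x := by
  have h : inner ℝ (coneMap α v x : EuclideanSpace ℝ (Fin (n + 1)))
      (equator (v x : EuclideanSpace ℝ (Fin n))) = Real.sin α := by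
    rw [coneMap_eq, inner_add_left, smul_apply, inner_smul_left, inner_smul_left, inner_equator,
      inner_self_sphere, inner_pole_equator]
    simp
  rw [tanProj, h, coneMap_eq, coneNormal]
  simp only [smul_apply]
  match_scalars <;> linarith [Real.sin_sq_add_cos_sq α]

variable {α : ℝ} {v : USphere a → USphere n}

lemma inner_coneMap_equator_sphD (hv : Extendable fun y => (v y : EuclideanSpace ℝ (Fin n)))
    (x : USphere a) (X : EuclideanSpace ℝ (Fin a)) :
    inner ℝ (coneMap α v x : EuclideanSpace ℝ (Fin (n + 1)))
      (equator (sphD (fun y => (v y : EuclideanSpace ℝ (Fin n))) x X)) = 0 := by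
  simp [coneMap_eq, inner_add_left, inner_smul_left, inner_equator, inner_sphD_eq_zero hv]

lemma sphD_coneMap (hv : Extendable fun y => (v y : EuclideanSpace ℝ (Fin n))) (x : USphere a)
    (X : EuclideanSpace ℝ (Fin a)) :
    sphD (fun y => (coneMap α v y : EuclideanSpace ℝ (Fin (n + 1)))) x X
      = (Real.sin α • equator) (sphD (fun y => (v y : EuclideanSpace ℝ (Fin n))) x X) := by
  simp_rw [coneMap_eq]
  exact sphD_affine hv _ _ x X

/-- The analytic content of being an eigenmap for the eigenvalue `μ` of the Laplacian: the map has
extendable derivatives of order at most one, and the trace of its Hessian is `-μ v`. -/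
structure IsLaplaceEigenmap (μ : ℝ) (v : USphere a → USphere n) : Prop where
  extendable : Extendable fun y => (v y : EuclideanSpace ℝ (Fin n))
  extendable_sphD : ∀ Y, Extendable fun y =>
    sphD (fun y => (v y : EuclideanSpace ℝ (Fin n))) y (tanField Y y)
  tanTrace_sphHess : ∀ x, tanTrace x (sphHess (fun y => (v y : EuclideanSpace ℝ (Fin n))) x)
    = -μ • (v x : EuclideanSpace ℝ (Fin n))

variable {μ : ℝ}

/-- The energy density of an eigenmap into the unit sphere is constant. -/
lemma IsLaplaceEigenmap.tanTrace_inner_sphD (hv : IsLaplaceEigenmap μ v) (x : USphere a) :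
    tanTrace x (fun X Y => inner ℝ (sphD (fun y => (v y : EuclideanSpace ℝ (Fin n))) x X)
      (sphD (fun y => (v y : EuclideanSpace ℝ (Fin n))) x Y)) = μ := by
  rw [tanTrace_congr x fun X Y _ hY =>
    (inner_sphD_sphD hv.extendable (hv.extendable_sphD Y) hY X).trans
      (by rw [← innerSL_apply_apply (𝕜 := ℝ), ← neg_apply, ← map_neg])]
  rw [tanTrace_clm, hv.tanTrace_sphHess]
  simp [inner_smul_right]

/-- Both the tension field and its connection Laplacian come down to this trace. -/
lemma IsLaplaceEigenmap.tanTrace_tanProj_sphHess (hv : IsLaplaceEigenmap μ v) (r : ℝ)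
    (x : USphere a) :
    tanTrace x (fun X Y => tanProj (coneMap α v x)
        ((r • equator) (sphHess (fun y => (v y : EuclideanSpace ℝ (Fin n))) x X Y)))
      = (r * μ * Real.cos α) • coneNormal α v x := by
  rw [tanTrace_tanProj, tanTrace_clm, hv.tanTrace_sphHess, map_smul,
    smul_apply, tanProj_smul, tanProj_smul, tanProj_coneMap_equator]
  module

lemma IsLaplaceEigenmap.tension_coneMap (hv : IsLaplaceEigenmap μ v) :
    tension (coneMap α v) = fun x => (Real.sin α * μ * Real.cos α) • coneNormal α v x := by
  funext x
  rw [tension, ← hv.tanTrace_tanProj_sphHess]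
  refine tanTrace_congr x fun X Y hX hY => ?_
  rw [secondForm_eq _ hY, sphHess]
  simp_rw [sphD_coneMap hv.extendable]
  rw [sphD_clm (hv.extendable_sphD Y)]
  rfl

lemma IsLaplaceEigenmap.pullD_tension_coneMap (hv : IsLaplaceEigenmap μ v) (y : USphere a)
    (X : EuclideanSpace ℝ (Fin a)) :
    pullD (coneMap α v) (tension (coneMap α v)) y X
      = (-(Real.sin α * μ * Real.cos α ^ 2) • equator)
        (sphD (fun y => (v y : EuclideanSpace ℝ (Fin n))) y X) := by
  have h : tension (coneMap α v) = fun x =>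
      ((-(Real.sin α * μ * Real.cos α ^ 2)) • equator) (v x : EuclideanSpace ℝ (Fin n))
        + (Real.sin α * μ * Real.cos α * Real.sin α) • pole := by
    rw [hv.tension_coneMap]
    funext x
    simp only [coneNormal, smul_apply]
    module
  rw [pullD, h, sphD_affine hv.extendable]
  exact tanProj_eq_self (by
    rw [smul_apply, inner_smul_right,
      inner_coneMap_equator_sphD hv.extendable, mul_zero])

lemma IsLaplaceEigenmap.pullLaplacian_tension_coneMap (hv : IsLaplaceEigenmap μ v)
    (x : USphere a) :
    pullLaplacian (coneMap α v) (tension (coneMap α v)) x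
      = (-(Real.sin α * μ * Real.cos α ^ 2) * μ * Real.cos α) • coneNormal α v x := by
  rw [pullLaplacian, ← hv.tanTrace_tanProj_sphHess]
  refine tanTrace_congr x fun X Y hX hY => ?_
  simp_rw [hv.pullD_tension_coneMap]
  rw [lcD_tanField_of_tangent hY, map_zero, map_zero, sub_zero, pullD,
    sphD_clm (hv.extendable_sphD Y)]
  rfl

lemma IsLaplaceEigenmap.tanTrace_curv_coneMap (hv : IsLaplaceEigenmap μ v) (x : USphere a) :
    tanTrace x (fun X Y => curv (coneMap α v x) (tension (coneMap α v) x)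
        (dMap (coneMap α v) x X) (dMap (coneMap α v) x Y))
      = (Real.sin α ^ 2 * μ) • tension (coneMap α v) x := by
  have hτ : inner ℝ (coneMap α v x : EuclideanSpace ℝ (Fin (n + 1)))
      (tension (coneMap α v) x) = 0 := by
    rw [hv.tension_coneMap, inner_smul_right, inner_coneMap_coneNormal, mul_zero]
  have hd : ∀ X, inner ℝ (coneMap α v x : EuclideanSpace ℝ (Fin (n + 1)))
      (dMap (coneMap α v) x X) = 0 := fun X => by
    rw [dMap, sphD_coneMap hv.extendable, smul_apply, inner_smul_right,
      inner_coneMap_equator_sphD hv.extendable, mul_zero]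
  -- The tension field is normal to the parallel that contains the image.
  have hτd : ∀ X, inner ℝ (tension (coneMap α v) x) (dMap (coneMap α v) x X) = 0 := fun X => by
    rw [dMap, sphD_coneMap hv.extendable, hv.tension_coneMap]
    simp [coneNormal, inner_smul_left, inner_smul_right, inner_add_left, inner_equator,
      inner_sphD_eq_zero hv.extendable]
  rw [tanTrace_congr x (C := fun X Y => (Real.sin α ^ 2) •
    ((ContinuousLinearMap.id ℝ ℝ).smulRight (tension (coneMap α v) x))
      (inner ℝ (sphD (fun y => (v y : EuclideanSpace ℝ (Fin n))) x X)
      (sphD (fun y => (v y : EuclideanSpace ℝ (Fin n))) x Y)))]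
  · rw [tanTrace_smul, tanTrace_clm, hv.tanTrace_inner_sphD]
    simp [mul_smul]
  · intro X Y _ _
    rw [curv_eq hτ (hd X) (hd Y), hτd, zero_smul, sub_zero, dMap, sphD_coneMap hv.extendable,
      sphD_coneMap hv.extendable]
    simp only [smul_apply, inner_smul_left, inner_smul_right, inner_equator,
      RCLike.conj_to_real, ContinuousLinearMap.smulRight_apply, ContinuousLinearMap.id_apply]
    module

end Cone

/-- On the round sphere the Ricci and scalar curvature terms are multiples of the tension field. -/
lemma IsLaplaceEigenmap.conformalBitension_coneMap {m n : ℕ} {μ α : ℝ}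
    {v : USphere (m + 1) → USphere n} (hv : IsLaplaceEigenmap μ v) (x : USphere (m + 1)) :
    conformalBitension (coneMap α v) x
      = (Real.sin α * Real.cos α * μ * (μ * (2 * Real.sin α ^ 2 - 1)
        - 2 / 3 * (((m : ℝ) - 1) * ((m : ℝ) - 3)))) • coneNormal α v x := by
  have hric : tanTrace x (fun X Y => secondForm (coneMap α v) x (ric x X) Y)
      = ((m : ℝ) - 1) • tension (coneMap α v) x := by
    rw [tension, ← tanTrace_smul]
    exact tanTrace_congr x fun X Y hX _ => by rw [ric_eq hX, secondForm_smul_left]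
  rw [conformalBitension, bitension, hv.pullLaplacian_tension_coneMap, hv.tanTrace_curv_coneMap,
    sphGrad_scal, map_zero, scal_eq, hric, hv.tension_coneMap]
  match_scalars
  rw [Real.cos_sq']
  ring

/-! ### Restrictions of homogeneous harmonic polynomial maps -/

section PolynomialMaps

variable {a b : ℕ}

/-- The polynomial map `ℝ^a → ℝ^b` with the given components. -/
noncomputable def polyMap (F : Fin b → MvPolynomial (Fin a) ℝ) (y : EuclideanSpace ℝ (Fin a)) :
    EuclideanSpace ℝ (Fin b) :=
  WithLp.toLp 2 fun i => MvPolynomial.eval (fun j => y j) (F i)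

lemma hasFDerivAt_eval (p : MvPolynomial (Fin a) ℝ) (x : EuclideanSpace ℝ (Fin a)) :
    HasFDerivAt (fun y : EuclideanSpace ℝ (Fin a) => MvPolynomial.eval (fun j => y j) p)
      (∑ j, MvPolynomial.eval (fun j => x j) (MvPolynomial.pderiv j p) •
        (EuclideanSpace.proj j : EuclideanSpace ℝ (Fin a) →L[ℝ] ℝ)) x := by
  induction p using MvPolynomial.induction_on with
  | C r => simpa using hasFDerivAt_const r x
  | add p q hp hq => simpa [add_smul, Finset.sum_add_distrib] using hp.fun_add hq
  | mul_X p i hp =>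
    have h := hp.mul (EuclideanSpace.proj i : EuclideanSpace ℝ (Fin a) →L[ℝ] ℝ).hasFDerivAt
    simp only [map_mul, MvPolynomial.eval_X]
    refine h.congr_fderiv ?_
    ext1 y
    have h1 : ∀ j, MvPolynomial.eval (fun j => x j)
        (Pi.single (M := fun _ => MvPolynomial (Fin a) ℝ) j 1 i) = if i = j then 1 else 0 :=
      fun j => by
        rw [Pi.single_apply]
        split_ifs <;> simp
    simp [MvPolynomial.pderiv_X, h1, add_mul, Finset.sum_add_distrib, Finset.mul_sum, mul_assoc]

lemma hasFDerivAt_polyMap (F : Fin b → MvPolynomial (Fin a) ℝ) (x : EuclideanSpace ℝ (Fin a)) :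
    HasFDerivAt (polyMap F)
      (∑ j, (EuclideanSpace.proj j : EuclideanSpace ℝ (Fin a) →L[ℝ] ℝ).smulRight
        (polyMap (fun i => MvPolynomial.pderiv j (F i)) x)) x := by
  rw [← hasFDerivWithinAt_univ, hasFDerivWithinAt_euclidean]
  intro i
  rw [hasFDerivWithinAt_univ]
  refine (hasFDerivAt_eval (F i) x).congr_fderiv ?_
  ext1 y
  simp [polyMap, mul_comm]

lemma differentiable_polyMap (F : Fin b → MvPolynomial (Fin a) ℝ) :
    Differentiable ℝ (polyMap F) :=
  fun x => (hasFDerivAt_polyMap F x).differentiableAt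

lemma contDiff_polyMap (F : Fin b → MvPolynomial (Fin a) ℝ) : ContDiff ℝ ∞ (polyMap F) := by
  rw [contDiff_euclidean]
  intro i
  have h := AnalyticOnNhd.eval_continuousLinearMap' (𝕜 := ℝ) (B := ℝ)
    (fun j => (EuclideanSpace.proj j : EuclideanSpace ℝ (Fin a) →L[ℝ] ℝ)) (F i)
  exact contDiffOn_univ.1 (h.contDiffOn uniqueDiffOn_univ)

/-- Euler's identity. -/
lemma sum_smul_polyMap_pderiv {k : ℕ} {F : Fin b → MvPolynomial (Fin a) ℝ}
    (hF : ∀ i, (F i).IsHomogeneous k) (x : EuclideanSpace ℝ (Fin a)) :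
    ∑ j, x j • polyMap (fun i => MvPolynomial.pderiv j (F i)) x = (k : ℝ) • polyMap F x := by
  ext i
  have := congrArg (MvPolynomial.eval fun j => x j) (hF i).sum_X_mul_pderiv
  simpa [polyMap] using this

variable {k : ℕ} {F : Fin b → MvPolynomial (Fin a) ℝ} {v : USphere a → USphere b}

lemma sphD_restrict_polyMap (hF : ∀ i, (F i).IsHomogeneous k)
    (h : ∀ x : USphere a, (v x : EuclideanSpace ℝ (Fin b)) = polyMap F x)
    (x : USphere a) (Y : EuclideanSpace ℝ (Fin a)) :
    sphD (fun y => (v y : EuclideanSpace ℝ (Fin b))) x Y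
      = ∑ j, Y j • polyMap (fun i => MvPolynomial.pderiv j (F i)) x
        - (inner ℝ (x : EuclideanSpace ℝ (Fin a)) Y * k) • polyMap F x := by
  rw [sphD_apply_of_hasFDerivAt h (hasFDerivAt_polyMap F x), mul_smul,
    ← sum_smul_polyMap_pderiv hF]
  simp [tanProj, sub_smul, Finset.smul_sum, mul_smul]

lemma sphD_tanField_restrict_polyMap (hF : ∀ i, (F i).IsHomogeneous k)
    (h : ∀ x : USphere a, (v x : EuclideanSpace ℝ (Fin b)) = polyMap F x)
    (Y : EuclideanSpace ℝ (Fin a)) (x : USphere a) :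
    sphD (fun y => (v y : EuclideanSpace ℝ (Fin b))) x (tanField Y x)
      = ∑ j, Y j • polyMap (fun i => MvPolynomial.pderiv j (F i)) x
        - (inner ℝ (x : EuclideanSpace ℝ (Fin a)) Y * k) • polyMap F x := by
  rw [← sphD_restrict_polyMap hF h, sphD_apply_of_hasFDerivAt h (hasFDerivAt_polyMap F x),
    sphD_apply_of_hasFDerivAt h (hasFDerivAt_polyMap F x), tanField, tanProj_tanProj]

lemma hasFDerivAt_sphD_tanField_extension (Y x : EuclideanSpace ℝ (Fin a)) :
    HasFDerivAt (fun x => ∑ j, Y j • polyMap (fun i => MvPolynomial.pderiv j (F i)) x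
        - (inner ℝ x Y * k) • polyMap F x)
      (∑ j, Y j • ∑ i, (EuclideanSpace.proj i : EuclideanSpace ℝ (Fin a) →L[ℝ] ℝ).smulRight
          (polyMap (fun l => MvPolynomial.pderiv i (MvPolynomial.pderiv j (F l))) x)
        - ((inner ℝ x Y * k) •
            (∑ j, (EuclideanSpace.proj j : EuclideanSpace ℝ (Fin a) →L[ℝ] ℝ).smulRight
              (polyMap (fun i => MvPolynomial.pderiv j (F i)) x))
          + ((k : ℝ) • innerSL ℝ Y).smulRight (polyMap F x))) x := by
  refine HasFDerivAt.sub (HasFDerivAt.fun_sum fun j _ => (hasFDerivAt_polyMap _ x).fun_const_smul _)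
    (HasFDerivAt.fun_smul ?_ (hasFDerivAt_polyMap F x))
  have : (fun y : EuclideanSpace ℝ (Fin a) => inner ℝ y Y * (k : ℝ))
      = ((k : ℝ) • innerSL ℝ Y : EuclideanSpace ℝ (Fin a) →L[ℝ] ℝ) := by
    funext y
    simp [real_inner_comm, mul_comm]
  rw [this]
  exact ContinuousLinearMap.hasFDerivAt _

lemma sphHess_restrict_polyMap (hF : ∀ i, (F i).IsHomogeneous k)
    (h : ∀ x : USphere a, (v x : EuclideanSpace ℝ (Fin b)) = polyMap F x) {x : USphere a}
    {X Y : EuclideanSpace ℝ (Fin a)} (hX : inner ℝ (x : EuclideanSpace ℝ (Fin a)) X = 0)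
    (hY : inner ℝ (x : EuclideanSpace ℝ (Fin a)) Y = 0) :
    sphHess (fun y => (v y : EuclideanSpace ℝ (Fin b))) x X Y
      = ∑ j, ∑ i, (X i * Y j) •
          polyMap (fun l => MvPolynomial.pderiv i (MvPolynomial.pderiv j (F l))) x
        - inner ℝ X Y • (k : ℝ) • polyMap F x := by
  rw [sphHess, sphD_apply_of_hasFDerivAt (sphD_tanField_restrict_polyMap hF h Y)
    (hasFDerivAt_sphD_tanField_extension Y (x : EuclideanSpace ℝ (Fin a))), tanProj_eq_self hX]
  simp [hY, Finset.smul_sum, smul_smul, mul_comm, real_inner_comm]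

end PolynomialMaps

/-- A homogeneous harmonic polynomial of degree `k` restricts to an eigenfunction of the Laplacian
of `S^m` for the eigenvalue `k (k + m - 1)`. -/
lemma isLaplaceEigenmap_of_polyMap {m n k : ℕ} (hk : 1 ≤ k)
    {F : Fin n → MvPolynomial (Fin (m + 1)) ℝ} {v : USphere (m + 1) → USphere n}
    (hF : ∀ i, (F i).IsHomogeneous k)
    (hΔ : ∀ i, ∑ j, MvPolynomial.pderiv j (MvPolynomial.pderiv j (F i)) = 0)
    (h : ∀ x : USphere (m + 1), (v x : EuclideanSpace ℝ (Fin n)) = polyMap F x) :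
    IsLaplaceEigenmap ((k : ℝ) * ((k : ℝ) + (m : ℝ) - 1)) v where
  extendable := ⟨polyMap F, differentiable_polyMap F, h⟩
  extendable_sphD Y := ⟨_,
    fun x => (hasFDerivAt_sphD_tanField_extension Y x).differentiableAt,
    sphD_tanField_restrict_polyMap hF h Y⟩
  tanTrace_sphHess x := by
    rw [tanTrace_congr x fun X Y hX hY => sphHess_restrict_polyMap hF h hX hY]
    have h1 := tanTrace_smul_const x ((k : ℝ) • polyMap F (x : EuclideanSpace ℝ (Fin (m + 1))))
    rw [tanTrace] at h1 ⊢
    rw [Finset.sum_sub_distrib, h1, Finset.sum_comm]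
    simp_rw [Finset.sum_comm (s := Finset.univ (α := Fin (Module.finrank _ _))),
      ← Finset.sum_smul, sum_tanBasis_apply_mul_apply, sub_smul, Finset.sum_sub_distrib]
    have h2 : ∑ j, ∑ i, (if i = j then (1 : ℝ) else 0) • polyMap (fun l =>
        MvPolynomial.pderiv i (MvPolynomial.pderiv j (F l)))
          (x : EuclideanSpace ℝ (Fin (m + 1))) = 0 := by
      ext l
      have := congrArg (MvPolynomial.eval fun j => (x : EuclideanSpace ℝ (Fin (m + 1))) j) (hΔ l)
      simpa [polyMap] using this
    have h3 : ∑ j, ∑ i, ((x : EuclideanSpace ℝ (Fin (m + 1))) i *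
        (x : EuclideanSpace ℝ (Fin (m + 1))) j) • polyMap (fun l =>
        MvPolynomial.pderiv i (MvPolynomial.pderiv j (F l)))
          (x : EuclideanSpace ℝ (Fin (m + 1)))
        = (((k - 1 : ℕ) : ℝ) * k) • polyMap F (x : EuclideanSpace ℝ (Fin (m + 1))) := by
      rw [mul_smul, ← sum_smul_polyMap_pderiv hF, Finset.smul_sum]
      refine Finset.sum_congr rfl fun j _ => ?_
      rw [smul_comm, ← sum_smul_polyMap_pderiv fun l => (hF l).pderiv, Finset.smul_sum]
      exact Finset.sum_congr rfl fun i _ => by rw [smul_smul, mul_comm]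
    rw [h2, h3, h, Nat.cast_sub hk]
    push_cast
    module

open scoped EuclideanSpace in
lemma contMDiff_coneMap {m n : ℕ} {F : Fin n → MvPolynomial (Fin (m + 1)) ℝ}
    {v : USphere (m + 1) → USphere n} (α : ℝ)
    (h : ∀ x : USphere (m + 1), (v x : EuclideanSpace ℝ (Fin n)) = polyMap F x) :
    ContMDiff (𝓡 m) (𝓡 n) ∞ (coneMap α v) := by
  have h1 : ContMDiff (𝓡 m) 𝓘(ℝ, EuclideanSpace ℝ (Fin (n + 1))) ∞
      (fun x => (coneMap α v x : EuclideanSpace ℝ (Fin (n + 1)))) := by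
    simp_rw [coneMap_eq, h]
    have h2 : ContDiff ℝ ∞ fun y => (Real.sin α • equator) (polyMap F y)
        + Real.cos α • pole :=
      ((Real.sin α • equator).contDiff.comp (contDiff_polyMap F)).add contDiff_const
    exact h2.contMDiff.comp (contMDiff_coe_sphere (E := EuclideanSpace ℝ (Fin (m + 1))))
  exact h1.codRestrict_sphere fun x => (coneMap α v x).2

/-- The conformal bitension field of the cone map over an eigenmap is a constant multiple of a unit
normal field. -/
lemma isConformalBiharmonic_coneMap_iff {m n k : ℕ} (hm : 1 ≤ m) (hk : 1 ≤ k)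
    {v : USphere (m + 1) → USphere n}
    (hv : IsEigenmapOfDegree k v) {α : ℝ} (hα : α ∈ Set.Ioo (0 : ℝ) (Real.pi / 2)) :
    (IsConformalBiharmonic (coneMap α v) ↔ Real.sin α ^ 2
        = (1 / 3 : ℝ) * ((((m : ℝ) - 1) * ((m : ℝ) - 3)) / ((k : ℝ) * ((k : ℝ) + (m : ℝ) - 1)))
          + 1 / 2) ∧
      ¬ IsHarmonicMap (coneMap α v) := by
  obtain ⟨F, hF, hΔ, hFv⟩ := hv
  have h : ∀ x : USphere (m + 1), (v x : EuclideanSpace ℝ (Fin n)) = polyMap F x :=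
    fun x => by ext i; exact hFv x i
  have hE := isLaplaceEigenmap_of_polyMap hk hF hΔ h
  have hkR : (1 : ℝ) ≤ k := by exact_mod_cast hk
  have hmR : (1 : ℝ) ≤ m := by exact_mod_cast hm
  have hμ : 0 < (k : ℝ) * ((k : ℝ) + (m : ℝ) - 1) := by
    apply mul_pos <;> linarith
  have hs : 0 < Real.sin α := Real.sin_pos_of_pos_of_lt_pi hα.1 (by linarith [hα.2, Real.pi_pos])
  have hc : 0 < Real.cos α := Real.cos_pos_of_mem_Ioo ⟨by linarith [hα.1, Real.pi_pos], hα.2⟩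
  set μ := (k : ℝ) * ((k : ℝ) + (m : ℝ) - 1)
  have hN : ∀ x, coneNormal α v x ≠ 0 := fun x h0 => by
    simpa [h0] using inner_coneNormal_self α v x
  let x₀ : USphere (m + 1) := ⟨EuclideanSpace.single 0 1, by simp⟩
  have hnonzero : Real.sin α * Real.cos α * μ ≠ 0 := by positivity
  constructor
  · have key : Real.sin α ^ 2 = (1 / 3 : ℝ) * ((((m : ℝ) - 1) * ((m : ℝ) - 3)) / μ) + 1 / 2 ↔
        μ * (2 * Real.sin α ^ 2 - 1) - 2 / 3 * (((m : ℝ) - 1) * ((m : ℝ) - 3)) = 0 := by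
      field_simp
      constructor <;> intro h <;> linarith
    rw [key, IsConformalBiharmonic, and_iff_right (contMDiff_coneMap α h)]
    simp_rw [hE.conformalBitension_coneMap]
    constructor
    · intro h0
      exact (mul_eq_zero.1 ((smul_eq_zero.1 (h0 x₀)).resolve_right (hN x₀))).resolve_left hnonzero
    · intro h0 x
      rw [h0, mul_zero, zero_smul]
  · rintro ⟨-, h0⟩
    have h1 := h0 x₀
    rw [hE.tension_coneMap] at h1
    refine hnonzero ?_
    linarith [(smul_eq_zero.1 h1).resolve_right (hN x₀)]

/-! ### Sums of squares over an orthonormal basis -/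

section OrthonormalBases

/-- In a finite-dimensional inner product space, the sum of the squares of a linear functional over
an orthonormal basis is the square of its norm. It is therefore unchanged when the functional is
composed with a linear isometry, and vanishes for the zero functional only. -/
lemma exists_family_sum_sq_invariant {V : Type*} [AddCommGroup V] [Module ℝ V]
    [FiniteDimensional ℝ V] (core : InnerProductSpace.Core ℝ V) :
    ∃ (n : ℕ) (b : Fin n → V),
      (∀ (L : V →ₗ[ℝ] ℝ) (U : V →ₗ[ℝ] V), (∀ f, core.inner (U f) (U f) = core.inner f f) →
        ∑ i, L (U (b i)) ^ 2 = ∑ i, L (b i) ^ 2) ∧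
      ∀ L : V →ₗ[ℝ] ℝ, L ≠ 0 → 0 < ∑ i, L (b i) ^ 2 := by
  let _ : NormedAddCommGroup V := core.toNormedAddCommGroup
  let _ : InnerProductSpace ℝ V := InnerProductSpace.ofCore core.toCore
  let b := stdOrthonormalBasis ℝ V
  refine ⟨_, b, fun L U hU => ?_, fun L hL => ?_⟩
  · let U' : V →ₗᵢ[ℝ] V := ⟨U, fun f => by
      rw [← sq_eq_sq₀ (norm_nonneg _) (norm_nonneg _), ← real_inner_self_eq_norm_sq,
        ← real_inner_self_eq_norm_sq]
      exact hU f⟩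
    have h1 := (b.map (U'.toLinearIsometryEquiv rfl)).norm_dual L.toContinuousLinearMap
    have h2 := b.norm_dual L.toContinuousLinearMap
    rw [h2] at h1
    exact h1.symm
  · refine (Finset.sum_nonneg fun i _ => sq_nonneg _).lt_of_ne' fun h => hL ?_
    rw [Finset.sum_eq_zero_iff_of_nonneg fun i _ => sq_nonneg _] at h
    exact b.toBasis.ext fun i => by simpa using h i (Finset.mem_univ i)

end OrthonormalBases

/-! ### An isometry-invariant space of harmonic polynomials -/

section HarmonicPolynomials

variable (d k : ℕ)

/-- The harmonic homogeneous polynomials of degree `k` in `d` variables. -/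
noncomputable def harmonicSubmodule : Submodule ℝ (MvPolynomial (Fin d) ℝ) :=
  MvPolynomial.homogeneousSubmodule (Fin d) ℝ k ⊓
    LinearMap.ker (∑ j, ((MvPolynomial.pderiv j : Derivation ℝ (MvPolynomial (Fin d) ℝ) _) :
      MvPolynomial (Fin d) ℝ →ₗ[ℝ] MvPolynomial (Fin d) ℝ) ∘ₗ
        ((MvPolynomial.pderiv j : Derivation ℝ (MvPolynomial (Fin d) ℝ) _) :
      MvPolynomial (Fin d) ℝ →ₗ[ℝ] MvPolynomial (Fin d) ℝ))

variable {d k} in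
lemma mem_harmonicSubmodule {p : MvPolynomial (Fin d) ℝ} : p ∈ harmonicSubmodule d k ↔
    p.IsHomogeneous k ∧ ∑ j, MvPolynomial.pderiv j (MvPolynomial.pderiv j p) = 0 := by
  simp [harmonicSubmodule]

/-- A polynomial as a function on Euclidean space. -/
noncomputable def evalLinear :
    MvPolynomial (Fin d) ℝ →ₗ[ℝ] (EuclideanSpace ℝ (Fin d) → ℝ) where
  toFun p y := MvPolynomial.eval (fun j => y j) p
  map_add' p q := by ext; simp
  map_smul' r p := by ext; simp

instance : FiniteDimensional ℝ (harmonicSubmodule d k) := by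
  have : FiniteDimensional ℝ (MvPolynomial.homogeneousSubmodule (Fin d) ℝ k) :=
    Module.Finite.iff_fg.2 (MvPolynomial.homogeneousSubmodule_fg _ _ _)
  exact Submodule.finiteDimensional_of_le inf_le_left

/-- The real and imaginary parts of the power `(∑ j, (a j + i b j) X j) ^ k`. -/
noncomputable def linearPow {d : ℕ} (a b : Fin d → ℝ) :
    ℕ → MvPolynomial (Fin d) ℝ × MvPolynomial (Fin d) ℝ
  | 0 => (1, 0)
  | k + 1 =>
    ((∑ j, MvPolynomial.C (a j) * MvPolynomial.X j) * (linearPow a b k).1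
        - (∑ j, MvPolynomial.C (b j) * MvPolynomial.X j) * (linearPow a b k).2,
      (∑ j, MvPolynomial.C (a j) * MvPolynomial.X j) * (linearPow a b k).2
        + (∑ j, MvPolynomial.C (b j) * MvPolynomial.X j) * (linearPow a b k).1)

variable {d}

lemma linearPow_isHomogeneous (a b : Fin d → ℝ) :
    (linearPow a b k).1.IsHomogeneous k ∧ (linearPow a b k).2.IsHomogeneous k := by
  have hlin : ∀ c : Fin d → ℝ,
      (∑ j, MvPolynomial.C (c j) * MvPolynomial.X j).IsHomogeneous 1 := fun c =>
    MvPolynomial.IsHomogeneous.sum _ _ _ fun j _ => MvPolynomial.isHomogeneous_C_mul_X _ _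
  induction k with
  | zero => exact ⟨MvPolynomial.isHomogeneous_one _ _, MvPolynomial.isHomogeneous_zero _ _ _⟩
  | succ k ih =>
    rw [linearPow, add_comm k 1]
    exact ⟨((hlin a).mul ih.1).sub ((hlin b).mul ih.2),
      ((hlin a).mul ih.2).add ((hlin b).mul ih.1)⟩

lemma pderiv_linear (c : Fin d → ℝ) (j : Fin d) :
    MvPolynomial.pderiv j (∑ i, MvPolynomial.C (c i) * MvPolynomial.X i)
      = (MvPolynomial.C (c j) : MvPolynomial (Fin d) ℝ) := by
  simp [MvPolynomial.pderiv_X, Pi.single_apply]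

lemma pderiv_linearPow (a b : Fin d → ℝ) (j : Fin d) :
    MvPolynomial.pderiv j (linearPow a b k).1
        = (k : MvPolynomial (Fin d) ℝ) * (MvPolynomial.C (a j) * (linearPow a b (k - 1)).1
          - MvPolynomial.C (b j) * (linearPow a b (k - 1)).2) ∧
      MvPolynomial.pderiv j (linearPow a b k).2
        = (k : MvPolynomial (Fin d) ℝ) * (MvPolynomial.C (a j) * (linearPow a b (k - 1)).2
          + MvPolynomial.C (b j) * (linearPow a b (k - 1)).1) := by
  induction k with
  | zero => simp [linearPow]
  | succ k ih =>
    rw [Nat.add_sub_cancel]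
    cases k with
    | zero => simp [linearPow, MvPolynomial.pderiv_X, Pi.single_apply]
    | succ k =>
      rw [Nat.add_sub_cancel] at ih
      rw [linearPow]
      simp only [map_add, map_sub, Derivation.leibniz, pderiv_linear, ih, smul_eq_mul]
      rw [linearPow]
      push_cast
      constructor <;> ring

lemma linearPow_mem_harmonicSubmodule {a b : EuclideanSpace ℝ (Fin d)} (hab : ‖a‖ = ‖b‖)
    (h : inner ℝ a b = 0) : (linearPow a b k).1 ∈ harmonicSubmodule d k := by
  refine mem_harmonicSubmodule.2 ⟨(linearPow_isHomogeneous k a b).1, ?_⟩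
  have h1 : ∑ j, (a j ^ 2 - b j ^ 2) = 0 := by
    rw [Finset.sum_sub_distrib, ← EuclideanSpace.real_norm_sq_eq, ← EuclideanSpace.real_norm_sq_eq,
      hab, sub_self]
  have h2 : ∑ j, a j * b j = 0 := by
    rw [← h, PiLp.inner_apply]
    simp [mul_comm]
  have h3 : ∀ j, MvPolynomial.pderiv j (MvPolynomial.pderiv j (linearPow a b k).1)
      = (k : MvPolynomial (Fin d) ℝ) * ((k - 1 : ℕ) : MvPolynomial (Fin d) ℝ) *
        (MvPolynomial.C (a j ^ 2 - b j ^ 2) * (linearPow a b (k - 1 - 1)).1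
          - 2 * MvPolynomial.C (a j * b j) * (linearPow a b (k - 1 - 1)).2) := by
    intro j
    rw [(pderiv_linearPow k a b j).1]
    simp only [Derivation.leibniz, map_sub, (pderiv_linearPow (k - 1) _ _ j).1,
      (pderiv_linearPow (k - 1) _ _ j).2, smul_eq_mul, MvPolynomial.pderiv_C,
      Derivation.map_natCast, map_mul, map_pow]
    ring
  simp_rw [h3]
  rw [← Finset.mul_sum, Finset.sum_sub_distrib, ← Finset.sum_mul, ← Finset.sum_mul,
    ← Finset.mul_sum, ← map_sum, ← map_sum, h1, h2]
  simp

lemma eval_linearPow (a b y : EuclideanSpace ℝ (Fin d)) :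
    MvPolynomial.eval (fun j => y j) (linearPow a b k).1
        = (((inner ℝ a y : ℝ) + (inner ℝ b y : ℝ) * Complex.I : ℂ) ^ k).re ∧
      MvPolynomial.eval (fun j => y j) (linearPow a b k).2
        = (((inner ℝ a y : ℝ) + (inner ℝ b y : ℝ) * Complex.I : ℂ) ^ k).im := by
  have h : ∀ c : EuclideanSpace ℝ (Fin d), MvPolynomial.eval (fun j => y j)
      (∑ j, MvPolynomial.C (c j) * MvPolynomial.X j) = inner ℝ c y := fun c => by
    simp [PiLp.inner_apply, mul_comm]
  induction k with
  | zero => simp [linearPow]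
  | succ k ih =>
    simp only [linearPow, map_sub, map_add, map_mul, h, ih, pow_succ', Complex.mul_re,
      Complex.mul_im]
    simp

/-- The functions `y ↦ Re ((⟨a, y⟩ + i ⟨b, y⟩) ^ k)` for orthogonal vectors `a`, `b` of equal
length, and their linear combinations. They are harmonic polynomials, and the definition makes it
plain that this space is invariant under isometries. -/
def isotropicSpan (d k : ℕ) : Submodule ℝ (EuclideanSpace ℝ (Fin d) → ℝ) :=
  Submodule.span ℝ {f | ∃ a b : EuclideanSpace ℝ (Fin d), ‖a‖ = ‖b‖ ∧ inner ℝ a b = 0 ∧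
    f = fun y => (((inner ℝ a y : ℝ) + (inner ℝ b y : ℝ) * Complex.I : ℂ) ^ k).re}

lemma isotropicSpan_le : isotropicSpan d k ≤ (harmonicSubmodule d k).map (evalLinear d) := by
  refine Submodule.span_le.2 ?_
  rintro _ ⟨a, b, hab, h, rfl⟩
  exact ⟨_, linearPow_mem_harmonicSubmodule k hab h, funext fun y => (eval_linearPow k a b y).1⟩

instance : FiniteDimensional ℝ (isotropicSpan d k) :=
  Submodule.finiteDimensional_of_le (isotropicSpan_le k)

variable {k}

lemma comp_mem_isotropicSpan (g : EuclideanSpace ℝ (Fin d) ≃ₗᵢ[ℝ] EuclideanSpace ℝ (Fin d))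
    {f : EuclideanSpace ℝ (Fin d) → ℝ} (hf : f ∈ isotropicSpan d k) :
    f ∘ g ∈ isotropicSpan d k := by
  suffices h : isotropicSpan d k ≤ (isotropicSpan d k).comap (LinearMap.funLeft ℝ ℝ g) from h hf
  refine Submodule.span_le.2 ?_
  rintro _ ⟨a, b, hab, h, rfl⟩
  refine Submodule.subset_span ⟨g.symm a, g.symm b, by simpa, by simpa, ?_⟩
  funext y
  have key : ∀ c, inner ℝ (g.symm c) y = inner ℝ c (g y) := fun c => by
    rw [← g.inner_map_map, g.apply_symm_apply]
  simp [LinearMap.funLeft_apply, key]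

lemma continuous_of_mem_isotropicSpan {f : EuclideanSpace ℝ (Fin d) → ℝ}
    (hf : f ∈ isotropicSpan d k) : Continuous f := by
  induction hf using Submodule.span_induction with
  | mem f hf =>
    obtain ⟨a, b, -, -, rfl⟩ := hf
    fun_prop
  | zero => exact continuous_const
  | add f g _ _ hf hg => exact hf.add hg
  | smul r f _ hf => exact hf.const_smul r

lemma map_smul_of_mem_isotropicSpan {f : EuclideanSpace ℝ (Fin d) → ℝ}
    (hf : f ∈ isotropicSpan d k) (t : ℝ) (y : EuclideanSpace ℝ (Fin d)) :
    f (t • y) = t ^ k * f y := by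
  induction hf using Submodule.span_induction with
  | mem f hf =>
    obtain ⟨a, b, -, -, rfl⟩ := hf
    have : (((inner ℝ a (t • y) : ℝ) : ℂ) + (inner ℝ b (t • y) : ℝ) * Complex.I)
        = (t : ℂ) * ((inner ℝ a y : ℝ) + (inner ℝ b y : ℝ) * Complex.I) := by
      simp only [inner_smul_right]
      push_cast
      ring
    simp only [this]
    rw [mul_pow, ← Complex.ofReal_pow, Complex.re_ofReal_mul]
  | zero => simp
  | add f g _ _ hf hg => simp [hf, hg, mul_add]
  | smul r f _ hf => simp [hf, mul_left_comm]

lemma hasCompactSupport_mul_bump (f : EuclideanSpace ℝ (Fin d) → ℝ) :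
    HasCompactSupport fun y => f y * max (1 - ‖y‖) 0 := by
  refine HasCompactSupport.intro (isCompact_closedBall (0 : EuclideanSpace ℝ (Fin d)) 1) ?_
  intro y hy
  rw [mem_closedBall_zero_iff, not_le] at hy
  rw [max_eq_right (by linarith), mul_zero]

lemma integrable_mul_bump {f : EuclideanSpace ℝ (Fin d) → ℝ} (hf : Continuous f) :
    MeasureTheory.Integrable fun y => f y * max (1 - ‖y‖) 0 :=
  Continuous.integrable_of_hasCompactSupport (by fun_prop) (hasCompactSupport_mul_bump f)

/-- The inner product `∫ f g` on homogeneous functions, weighted by the radial bump function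
`max (1 - |y|) 0` so that the integrals converge. -/
@[reducible] noncomputable def isotropicCore : InnerProductSpace.Core ℝ (isotropicSpan d k) where
  inner f g := ∫ y, f.1 y * g.1 y * max (1 - ‖y‖) 0
  conj_inner_symm f g := by simp only [mul_comm (f.1 _), RCLike.conj_to_real]
  re_inner_nonneg f := MeasureTheory.integral_nonneg fun y =>
    mul_nonneg (mul_self_nonneg _) (le_max_right _ _)
  add_left f g h := by
    have hf := continuous_of_mem_isotropicSpan f.2
    have hg := continuous_of_mem_isotropicSpan g.2
    have hh := continuous_of_mem_isotropicSpan h.2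
    refine Eq.trans ?_ (MeasureTheory.integral_add (integrable_mul_bump (hf.mul hh))
      (integrable_mul_bump (hg.mul hh)))
    refine MeasureTheory.integral_congr_ae (Filter.Eventually.of_forall fun y => ?_)
    simp only [Submodule.coe_add, Pi.add_apply]
    ring
  smul_left f g r := by
    rw [RCLike.conj_to_real, ← MeasureTheory.integral_const_mul]
    refine MeasureTheory.integral_congr_ae (Filter.Eventually.of_forall fun y => ?_)
    simp only [Submodule.coe_smul, Pi.smul_apply, smul_eq_mul]
    ring
  definite f h := by
    have hf := continuous_of_mem_isotropicSpan f.2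
    by_contra hne
    obtain ⟨y, hy⟩ : ∃ y, f.1 y ≠ 0 := by
      by_contra! h0
      exact hne (Subtype.ext (funext h0))
    -- By homogeneity `f` is nonzero at some point of the open unit ball.
    have ht : 0 < (1 + ‖y‖)⁻¹ := by positivity
    have hz : f.1 ((1 + ‖y‖)⁻¹ • y) ≠ 0 := by
      rw [map_smul_of_mem_isotropicSpan f.2]
      positivity
    have hlt : ‖(1 + ‖y‖)⁻¹ • y‖ < 1 := by
      rw [norm_smul, Real.norm_of_nonneg ht.le, inv_mul_lt_one₀ (by positivity)]
      linarith
    refine (Continuous.integral_pos_of_hasCompactSupport_nonneg_nonzero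
      (f := fun y => f.1 y * f.1 y * max (1 - ‖y‖) 0) (x := (1 + ‖y‖)⁻¹ • y) (by fun_prop)
      (hasCompactSupport_mul_bump _)
      (fun y => mul_nonneg (mul_self_nonneg _) (le_max_right _ _)) ?_).ne' h
    exact mul_ne_zero (mul_ne_zero hz hz) (lt_max_of_lt_left (by linarith)).ne'

end HarmonicPolynomials

/-! ### Existence of eigenmaps -/

/-- Eigenmaps of every degree exist: for an orthonormal basis of an isometry-invariant space of
harmonic polynomials, the sum of the squares is an isometry-invariant function, hence constant on
the sphere. -/
lemma exists_isEigenmapOfDegree {m : ℕ} (hm : 1 ≤ m) (k : ℕ) :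
    ∃ (n : ℕ) (v : USphere (m + 1) → USphere n), IsEigenmapOfDegree k v := by
  obtain ⟨n, b, hb, hpos⟩ := exists_family_sum_sq_invariant (isotropicCore (d := m + 1) (k := k))
  let ev (y : EuclideanSpace ℝ (Fin (m + 1))) : isotropicSpan (m + 1) k →ₗ[ℝ] ℝ :=
    LinearMap.proj y ∘ₗ (isotropicSpan (m + 1) k).subtype
  let x₀ : USphere (m + 1) := ⟨EuclideanSpace.single 0 1, by simp⟩
  have hev : ev x₀ ≠ 0 := by
    intro h0
    let e : EuclideanSpace ℝ (Fin (m + 1)) := EuclideanSpace.single (Fin.last m) 1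
    have hne : Fin.last m ≠ 0 := by
      rw [Ne, Fin.last_eq_zero_iff]
      omega
    have h1 : inner ℝ e (x₀ : EuclideanSpace ℝ (Fin (m + 1))) = 0 := by
      simp [e, x₀, EuclideanSpace.inner_single_left, hne]
    have := LinearMap.congr_fun h0 ⟨_, Submodule.subset_span
      ⟨(x₀ : EuclideanSpace ℝ (Fin (m + 1))), e, by simp [e], by rw [real_inner_comm, h1], rfl⟩⟩
    simp [ev, h1] at this
  set c := ∑ i, ev x₀ (b i) ^ 2 with hc
  have hcpos : 0 < c := hpos _ hev
  have hconst : ∀ x : USphere (m + 1), ∑ i, ev x (b i) ^ 2 = c := by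
    intro x
    -- The reflection exchanging `x₀` and `x`.
    let g := Submodule.reflection
      (ℝ ∙ ((x₀ : EuclideanSpace ℝ (Fin (m + 1))) - x))ᗮ
    have hg : g x₀ = x := Submodule.reflection_sub (by simp)
    let U : isotropicSpan (m + 1) k →ₗ[ℝ] isotropicSpan (m + 1) k :=
      (LinearMap.funLeft ℝ ℝ g).restrict fun f hf => comp_mem_isotropicSpan g hf
    have h := hb (ev x₀) U fun f => by
      have := g.measurePreserving.integral_comp g.toHomeomorph.measurableEmbedding
        (fun y => f.1 y * f.1 y * max (1 - ‖y‖) 0)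
      simp only [LinearIsometryEquiv.norm_map] at this
      exact this
    rw [hc, ← h, ← hg]
    rfl
  choose F hF hFb using fun i => isotropicSpan_le k ((√c)⁻¹ • b i).2
  have hFe : ∀ i (x : EuclideanSpace ℝ (Fin (m + 1))),
      MvPolynomial.eval (fun j => x j) (F i) = (√c)⁻¹ * ev x (b i) :=
    fun i x => congrFun (hFb i) x
  refine ⟨n, fun x => ⟨polyMap F x, ?_⟩, F, fun i => (mem_harmonicSubmodule.1 (hF i)).1,
    fun i => (mem_harmonicSubmodule.1 (hF i)).2, fun x i => rfl⟩
  rw [mem_sphere_zero_iff_norm, EuclideanSpace.norm_eq, Real.sqrt_eq_one]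
  simp only [polyMap, hFe, Real.norm_eq_abs, sq_abs, mul_pow]
  rw [← Finset.mul_sum, hconst, inv_pow, Real.sq_sqrt hcpos.le, inv_mul_cancel₀ hcpos.ne']

/-! ### The condition on the degree -/

lemma exists_sin_sq_eq_iff (r : ℝ) :
    (∃ α ∈ Set.Ioo (0 : ℝ) (Real.pi / 2), Real.sin α ^ 2 = r) ↔ 0 < r ∧ r < 1 := by
  constructor
  · rintro ⟨α, hα, rfl⟩
    have hs : 0 < Real.sin α :=
      Real.sin_pos_of_pos_of_lt_pi hα.1 (by linarith [hα.2, Real.pi_pos])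
    have hc : 0 < Real.cos α := Real.cos_pos_of_mem_Ioo ⟨by linarith [hα.1, Real.pi_pos], hα.2⟩
    exact ⟨by positivity, by nlinarith [Real.sin_sq_add_cos_sq α]⟩
  · rintro ⟨h0, h1⟩
    have h2 : 0 < √r := Real.sqrt_pos.2 h0
    have h3 : √r < 1 := by rwa [Real.sqrt_lt' one_pos, one_pow]
    refine ⟨Real.arcsin √r, ⟨Real.arcsin_pos.2 h2, Real.arcsin_lt_pi_div_two.2 h3⟩, ?_⟩
    rw [Real.sin_arcsin (by linarith) h3.le, Real.sq_sqrt h0.le]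

/-- The degree condition says that `k` exceeds the larger root of
`3 k (k + m - 1) = 2 (m - 1) (m - 3)`. For `m = 2` the discriminant is negative. -/
lemma sin_sq_value_mem_Ioo_iff {m k : ℕ} (hm : 1 ≤ m) (hk : 1 ≤ k) :
    (0 < (1 / 3 : ℝ) * ((((m : ℝ) - 1) * ((m : ℝ) - 3)) / ((k : ℝ) * ((k : ℝ) + (m : ℝ) - 1)))
          + 1 / 2 ∧
      (1 / 3 : ℝ) * ((((m : ℝ) - 1) * ((m : ℝ) - 3)) / ((k : ℝ) * ((k : ℝ) + (m : ℝ) - 1)))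
          + 1 / 2 < 1) ↔
      (m ≠ 2 → (k : ℝ) >
        (1 / 6 : ℝ) * (√3 * √(11 * (m : ℝ) ^ 2 - 38 * (m : ℝ) + 27) - 3 * (m : ℝ) + 3)) := by
  have hkR : (1 : ℝ) ≤ k := by exact_mod_cast hk
  have hmR : (1 : ℝ) ≤ m := by exact_mod_cast hm
  have hμ : 0 < (k : ℝ) * ((k : ℝ) + (m : ℝ) - 1) := by
    apply mul_pos <;> linarith
  have hμ1 : (m : ℝ) ≤ (k : ℝ) * ((k : ℝ) + (m : ℝ) - 1) := by nlinarith
  have hlow : 0 < (1 / 3 : ℝ) *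
      ((((m : ℝ) - 1) * ((m : ℝ) - 3)) / ((k : ℝ) * ((k : ℝ) + (m : ℝ) - 1))) + 1 / 2 := by
    have : -1 ≤ (((m : ℝ) - 1) * ((m : ℝ) - 3)) / ((k : ℝ) * ((k : ℝ) + (m : ℝ) - 1)) := by
      rw [le_div_iff₀ hμ]
      nlinarith [sq_nonneg ((m : ℝ) - 2)]
    linarith
  rw [and_iff_right hlow]
  have hup : ∀ D μ : ℝ, 0 < μ → ((1 / 3 : ℝ) * (D / μ) + 1 / 2 < 1 ↔ 2 * D < 3 * μ) := by
    intro D μ hμ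
    rw [← sub_pos, ← sub_pos (a := 3 * μ), ← div_pos_iff_of_pos_right (mul_pos (by simp) hμ :
      0 < 6 * μ)]
    field_simp
    ring_nf
  rw [hup _ _ hμ]
  by_cases h2 : m = 2
  · subst h2
    refine iff_of_true ?_ fun h => absurd rfl h
    push_cast
    nlinarith
  · rw [← Real.sqrt_mul (by norm_num)]
    have hroot : (k : ℝ) > (1 / 6 : ℝ) *
        (√(3 * (11 * (m : ℝ) ^ 2 - 38 * (m : ℝ) + 27)) - 3 * (m : ℝ) + 3) ↔
        √(3 * (11 * (m : ℝ) ^ 2 - 38 * (m : ℝ) + 27)) < 6 * k + 3 * m - 3 := by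
      constructor <;> intro h <;> linarith
    rw [imp_iff_right h2, hroot, Real.sqrt_lt' (by linarith)]
    constructor <;> intro h <;> nlinarith

end SphereMaps

theorem mainTheorem6 (m : ℕ) (hm : 1 ≤ m) :
    (∀ (n k : ℕ) (v : USphere (m + 1) → USphere n), 1 ≤ k → IsEigenmapOfDegree k v →
      (∀ α ∈ Set.Ioo (0 : ℝ) (Real.pi / 2),
        (IsConformalBiharmonic (coneMap α v) ↔
          Real.sin α ^ 2
            = (1 / 3 : ℝ) * ((((m : ℝ) - 1) * ((m : ℝ) - 3)) / ((k : ℝ) * ((k : ℝ) + (m : ℝ) - 1)))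
              + 1 / 2) ∧
        ¬ IsHarmonicMap (coneMap α v)) ∧
      ((∃ α ∈ Set.Ioo (0 : ℝ) (Real.pi / 2), IsConformalBiharmonic (coneMap α v)) ↔
        (m ≠ 2 → (k : ℝ) >
          (1 / 6 : ℝ) * (√3 * √(11 * (m : ℝ) ^ 2 - 38 * (m : ℝ) + 27) - 3 * (m : ℝ) + 3)))) ∧
    (∃ k₀ : ℕ, 1 ≤ k₀ ∧ ∀ k : ℕ, k₀ ≤ k →
      (m ≠ 2 → (k : ℝ) >
        (1 / 6 : ℝ) * (√3 * √(11 * (m : ℝ) ^ 2 - 38 * (m : ℝ) + 27) - 3 * (m : ℝ) + 3)) ∧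
      ∃ (n : ℕ) (v : USphere (m + 1) → USphere n), IsEigenmapOfDegree k v ∧
        ∃ α ∈ Set.Ioo (0 : ℝ) (Real.pi / 2),
          IsConformalBiharmonic (coneMap α v) ∧ ¬ IsHarmonicMap (coneMap α v)) := by
  have hexists : ∀ (n k : ℕ) (v : USphere (m + 1) → USphere n), 1 ≤ k → IsEigenmapOfDegree k v →
      ((∃ α ∈ Set.Ioo (0 : ℝ) (Real.pi / 2), IsConformalBiharmonic (coneMap α v)) ↔
        (m ≠ 2 → (k : ℝ) >
          (1 / 6 : ℝ) * (√3 * √(11 * (m : ℝ) ^ 2 - 38 * (m : ℝ) + 27) - 3 * (m : ℝ) + 3))) := by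
    intro n k v hk hv
    rw [← sin_sq_value_mem_Ioo_iff hm hk, ← exists_sin_sq_eq_iff]
    exact exists_congr fun α => and_congr_right fun hα =>
      (isConformalBiharmonic_coneMap_iff hm hk hv hα).1
  refine ⟨fun n k v hk hv => ⟨fun α hα => isConformalBiharmonic_coneMap_iff hm hk hv hα,
    hexists n k v hk hv⟩, ?_⟩
  obtain ⟨k₁, hk₁⟩ := exists_nat_gt
    ((1 / 6 : ℝ) * (√3 * √(11 * (m : ℝ) ^ 2 - 38 * (m : ℝ) + 27) - 3 * (m : ℝ) + 3))
  refine ⟨max 1 k₁, le_max_left _ _, fun k hk => ?_⟩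
  have hgt : m ≠ 2 → (k : ℝ) >
      (1 / 6 : ℝ) * (√3 * √(11 * (m : ℝ) ^ 2 - 38 * (m : ℝ) + 27) - 3 * (m : ℝ) + 3) :=
    fun _ => hk₁.trans_le (by exact_mod_cast (le_max_right 1 k₁).trans hk)
  have hk1 : 1 ≤ k := (le_max_left 1 k₁).trans hk
  obtain ⟨n, v, hv⟩ := exists_isEigenmapOfDegree hm k
  obtain ⟨α, hα, hbi⟩ := (hexists n k v hk1 hv).2 hgt
  exact ⟨hgt, n, v, hv, α, hα, hbi, (isConformalBiharmonic_coneMap_iff hm hk1 hv hα).2⟩
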